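/- Let $n,s\ge 1$ and let $M$ be a smooth manifold of dimension $2n+s$ with a weak metric $f$-structure $(f,Q,\xi_i,\eta^i,g)_{1\le i\le s}$: $f$ is a smooth $(1,1)$-tensor of rank $2n$, $Q$ a smooth non-singular $(1,1)$-tensor, $\xi_i$ are smooth vector fields, $\eta^i$ smooth 1-forms and $g$ a Riemannian metric such that $$f^2=-Q+\sum_i\eta^i\otimes\xi_i,\qquad \eta^i(\xi_j)=\delta^i_j,\qquad Q\,\xi_i=\xi_i,\qquad g(fX,fY)=g(X,QY)-\sum_i\eta^i(X)\,\eta^i(Y),$$ and the distribution $\mathcal D=\bigcap_i\ker\eta^i$ is $f$-invariant. Suppose that it is a weak almost $\mathcal S$-structure, that is, $d\eta^i(X,Y)=g(X,fY)$ for all $i$ and all vector fields $X,Y$, where $d\eta(X,Y)=\frac12\{X(\eta(Y))-Y(\eta(X))-\eta([X,Y])\}$. Put $\bar\eta=\sum_i\eta^i$ and $h_i=\frac12\pounds_{\xi_i}f$, let $\nabla$ be the Levi-Civita connection of $g$ and $R_{X,Y}=\nabla_X\nabla_Y-\nabla_Y\nabla_X-\nabla_{[X,Y]}$. Suppose that for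 some $\mu\in\mathbb R$ $$R_{X,Y}\,\xi_i=\bar\eta(X)f^2Y-\bar\eta(Y)f^2X+\mu\{\bar\eta(Y)h_iX-\bar\eta(X)h_iY\}$$ for all $i$ and all vector fields $X,Y$ (the $(\kappa,\mu)$-nullity condition with $\kappa=1$), that $\pounds_{\xi_i}Q=0$ for all $i$, and that $(\nabla_XQ)Y=0$ for all vector fields $X,Y$ tangent to $\mathcal D$. Then $M$ is an $\mathcal S$-manifold: the structure is normal, i.e. $[f,f]+2\sum_i d\eta^i\otimes\xi_i=0$, where $[f,f](X,Y)=f^2[X,Y]+[fX,fY]-f[fX,Y]-f[X,fY]$, and $Q$ is the identity, so that $(f,\xi_i,\eta^i,g)$ is a classical metric $f$-structure with $d\eta^i(X,Y)=g(X,fY)$ for all $i$. -/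

import Mathlib

open Bundle VectorField
open scoped Manifold ContDiff

noncomputable section

namespace WeakF

/-- A smooth Riemannian metric on a smooth `d`-dimensional manifold. -/
abbrev RMetric (d : ℕ) (M : Type*) [TopologicalSpace M] [ChartedSpace (EuclideanSpace ℝ (Fin d)) M]
  [IsManifold (𝓡 d) ∞ M] :=
  ContMDiffRiemannianMetric (𝓡 d) ∞ (EuclideanSpace ℝ (Fin d)) (fun x : M ↦ TangentSpace (𝓡 d) x)

section LeviCivita

variable {d : ℕ} {M : Type*} [TopologicalSpace M] [ChartedSpace (EuclideanSpace ℝ (Fin d)) M]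
  [IsManifold (𝓡 d) ∞ M]

/-- A (not necessarily smooth) vector field. -/
abbrev VF (d : ℕ) (M : Type*) [TopologicalSpace M] [ChartedSpace (EuclideanSpace ℝ (Fin d)) M] :=
  Π x : M, TangentSpace (𝓡 d) x

/-- The vector field `X` is differentiable at `x`. -/
abbrev DiffAt (X : VF d M) (x : M) : Prop :=
  MDifferentiableAt (𝓡 d) ((𝓡 d).prod 𝓘(ℝ, EuclideanSpace ℝ (Fin d)))
    (fun y ↦ TotalSpace.mk' (EuclideanSpace ℝ (Fin d)) y (X y)) x

/-- The right-hand side of the Koszul formula for `2 g(∇_X Y, Z)`. -/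
def koszul (g : RMetric d M) (X Y Z : VF d M) (x : M) : ℝ :=
  mvfderiv (𝓡 d) (fun y ↦ g.inner y (Y y) (Z y)) x (X x)
  + mvfderiv (𝓡 d) (fun y ↦ g.inner y (Z y) (X y)) x (Y x)
  - mvfderiv (𝓡 d) (fun y ↦ g.inner y (X y) (Y y)) x (Z x)
  + g.inner x (mlieBracket (𝓡 d) X Y x) (Z x)
  - g.inner x (mlieBracket (𝓡 d) Y Z x) (X x)
  + g.inner x (mlieBracket (𝓡 d) Z X x) (Y x)

theorem mdiff_inner (g : RMetric d M) {Y Z : VF d M} {x : M}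
    (hY : DiffAt Y x) (hZ : DiffAt Z x) :
    MDifferentiableAt (𝓡 d) 𝓘(ℝ, ℝ) (fun y ↦ g.inner y (Y y) (Z y)) x := by
  have : MDifferentiableAt (𝓡 d) ((𝓡 d).prod 𝓘(ℝ))
      (fun m ↦ TotalSpace.mk' ℝ (E := Bundle.Trivial M ℝ) m (g.inner m (Y m) (Z m))) x := by
    apply MDifferentiableAt.clm_bundle_apply₂ (F₁ := EuclideanSpace ℝ (Fin d))
      (F₂ := EuclideanSpace ℝ (Fin d))
    · exact g.contMDiff.contMDiffAt.mdifferentiableAt (by simp)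
    · exact hY
    · exact hZ
  simp only [mdifferentiableAt_totalSpace] at this
  exact this.2

instance (x : M) : T2Space (TangentSpace (𝓡 d) x) :=
  inferInstanceAs (T2Space (EuclideanSpace ℝ (Fin d)))
instance (x : M) : FiniteDimensional ℝ (TangentSpace (𝓡 d) x) :=
  inferInstanceAs (FiniteDimensional ℝ (EuclideanSpace ℝ (Fin d)))

theorem koszul_tensorial_left (g : RMetric d M) (Y Z : VF d M) {x : M}
    (hY : DiffAt Y x) (hZ : DiffAt Z x) :
    TensorialAt (𝓡 d) (EuclideanSpace ℝ (Fin d)) (fun X ↦ koszul g X Y Z x) x where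
  smul {f X} hf hX := by
    have h1 : (fun y ↦ g.inner y (Z y) ((f • X) y)) = fun y ↦ f y * g.inner y (Z y) (X y) := by
      ext y; simp
    have h2 : (fun y ↦ g.inner y ((f • X) y) (Y y)) = fun y ↦ f y * g.inner y (X y) (Y y) := by
      ext y; simp
    simp only [koszul, h1, h2, mvfderiv_fun_mul hf (mdiff_inner g hZ hX),
      mvfderiv_fun_mul hf (mdiff_inner g hX hY), mlieBracket_smul_left hf hX,
      mlieBracket_smul_right hf hX]
    simp [g.symm x (Z x) (X x), g.symm x (X x) (Y x)]
    ring
  add {X X'} hX hX' := by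
    have h1 : (fun y ↦ g.inner y (Z y) ((X + X') y)) =
        fun y ↦ g.inner y (Z y) (X y) + g.inner y (Z y) (X' y) := by
      ext y; simp
    have h2 : (fun y ↦ g.inner y ((X + X') y) (Y y)) =
        fun y ↦ g.inner y (X y) (Y y) + g.inner y (X' y) (Y y) := by
      ext y; simp
    simp only [koszul, h1, h2, mvfderiv_fun_add (mdiff_inner g hZ hX) (mdiff_inner g hZ hX'),
      mvfderiv_fun_add (mdiff_inner g hX hY) (mdiff_inner g hX' hY), mlieBracket_add_left hX hX',
      mlieBracket_add_right hX hX']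
    simp
    ring

theorem koszul_tensorial_right (g : RMetric d M) (X Y : VF d M) {x : M}
    (hX : DiffAt X x) (hY : DiffAt Y x) :
    TensorialAt (𝓡 d) (EuclideanSpace ℝ (Fin d)) (fun Z ↦ koszul g X Y Z x) x where
  smul {f Z} hf hZ := by
    have h1 : (fun y ↦ g.inner y ((f • Z) y) (X y)) = fun y ↦ f y * g.inner y (Z y) (X y) := by
      ext y; simp
    have h2 : (fun y ↦ g.inner y (Y y) ((f • Z) y)) = fun y ↦ f y * g.inner y (Y y) (Z y) := by
      ext y; simp
    simp only [koszul, h1, h2, mvfderiv_fun_mul hf (mdiff_inner g hZ hX),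
      mvfderiv_fun_mul hf (mdiff_inner g hY hZ), mlieBracket_smul_left hf hZ,
      mlieBracket_smul_right hf hZ]
    simp [g.symm x (Z x) (X x), g.symm x (Z x) (Y x)]
    ring
  add {Z Z'} hZ hZ' := by
    have h1 : (fun y ↦ g.inner y ((Z + Z') y) (X y)) =
        fun y ↦ g.inner y (Z y) (X y) + g.inner y (Z' y) (X y) := by
      ext y; simp
    have h2 : (fun y ↦ g.inner y (Y y) ((Z + Z') y)) =
        fun y ↦ g.inner y (Y y) (Z y) + g.inner y (Y y) (Z' y) := by
      ext y; simp
    simp only [koszul, h1, h2, mvfderiv_fun_add (mdiff_inner g hZ hX) (mdiff_inner g hZ' hX),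
      mvfderiv_fun_add (mdiff_inner g hY hZ) (mdiff_inner g hY hZ'), mlieBracket_add_left hZ hZ',
      mlieBracket_add_right hZ hZ']
    simp
    ring


open Classical in
/-- At a point `x` at which `Y` is differentiable, the bilinear form
`(X(x), Z(x)) ↦ koszul X Y Z (x)` on the tangent space at `x`. -/
def koszulForm (g : RMetric d M) (Y : VF d M) (x : M) :
    TangentSpace (𝓡 d) x →L[ℝ] TangentSpace (𝓡 d) x →L[ℝ] ℝ :=
  if hY : DiffAt Y x then
    TensorialAt.mkHom₂ (fun X Z ↦ koszul g X Y Z x) x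
      (fun Z hZ ↦ koszul_tensorial_left g Y Z hY hZ)
      (fun X hX ↦ koszul_tensorial_right g X Y hX hY)
  else 0

theorem koszulForm_apply (g : RMetric d M) {X Y Z : VF d M} {x : M}
    (hX : DiffAt X x) (hY : DiffAt Y x) (hZ : DiffAt Z x) :
    koszulForm g Y x (X x) (Z x) = koszul g X Y Z x := by
  rw [koszulForm, dif_pos hY, TensorialAt.mkHom₂_apply _ _ hX hZ]

/-- The isomorphism `v ↦ g(v, ·)` of a tangent space with its dual. -/
def flat (g : RMetric d M) (x : M) :
    TangentSpace (𝓡 d) x ≃ₗ[ℝ] (TangentSpace (𝓡 d) x →L[ℝ] ℝ) :=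
  LinearEquiv.ofBijective (g.inner x : TangentSpace (𝓡 d) x →ₗ[ℝ] _) <| by
    have hinj : Function.Injective (g.inner x) := by
      rw [injective_iff_map_eq_zero]
      intro v hv
      by_contra h
      have := g.pos x v h
      simp [hv] at this
    refine ⟨hinj, ?_⟩
    have hfin : Module.finrank ℝ (TangentSpace (𝓡 d) x) =
        Module.finrank ℝ (TangentSpace (𝓡 d) x →L[ℝ] ℝ) := by
      rw [← (LinearMap.toContinuousLinearMap : (TangentSpace (𝓡 d) x →ₗ[ℝ] ℝ) ≃ₗ[ℝ] _).finrank_eq]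
      exact Subspace.dual_finrank_eq.symm
    exact (LinearMap.injective_iff_surjective_of_finrank_eq_finrank hfin).1 hinj

theorem inner_flat_symm (g : RMetric d M) (x : M) (φ : TangentSpace (𝓡 d) x →L[ℝ] ℝ)
    (w : TangentSpace (𝓡 d) x) : g.inner x ((flat g x).symm φ) w = φ w := by
  have := (flat g x).apply_symm_apply φ
  exact congr($this w)

theorem mdiff_extend {x : M} (v : TangentSpace (𝓡 d) x) :
    DiffAt (FiberBundle.extend (EuclideanSpace ℝ (Fin d)) v) x :=
  FiberBundle.mdifferentiableAt_extend ..

/-- `leviCivitaFun g Y x v` is `∇_v Y` at `x`, obtained from the Koszul formula. -/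
def leviCivitaFun (g : RMetric d M) (Y : VF d M) (x : M) :
    TangentSpace (𝓡 d) x →L[ℝ] TangentSpace (𝓡 d) x :=
  (1 / 2 : ℝ) • LinearMap.toContinuousLinearMap
    ((flat g x).symm.toLinearMap ∘ₗ (koszulForm g Y x : _ →ₗ[ℝ] _))

theorem leviCivitaFun_inner (g : RMetric d M) (Y : VF d M) (x : M)
    (v w : TangentSpace (𝓡 d) x) :
    g.inner x (leviCivitaFun g Y x v) w = 1 / 2 * koszulForm g Y x v w := by
  simp [leviCivitaFun, inner_flat_symm]


theorem eq_of_inner (g : RMetric d M) {x : M} {u v : TangentSpace (𝓡 d) x}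
    (h : ∀ w, g.inner x u w = g.inner x v w) : u = v :=
  (flat g x).injective (ContinuousLinearMap.ext h)

theorem leviCivitaFun_koszul (g : RMetric d M) {X Y Z : VF d M} {x : M}
    (hX : DiffAt X x) (hY : DiffAt Y x) (hZ : DiffAt Z x) :
    g.inner x (leviCivitaFun g Y x (X x)) (Z x) = 1 / 2 * koszul g X Y Z x := by
  rw [leviCivitaFun_inner, koszulForm_apply g hX hY hZ]

theorem extend_self {x : M} (v : TangentSpace (𝓡 d) x) :
    FiberBundle.extend (EuclideanSpace ℝ (Fin d)) v x = v :=
  FiberBundle.extend_apply_self ..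

theorem koszul_add (g : RMetric d M) {X Y Y' Z : VF d M} {x : M}
    (hX : DiffAt X x) (hY : DiffAt Y x) (hY' : DiffAt Y' x) (hZ : DiffAt Z x) :
    koszul g X (Y + Y') Z x = koszul g X Y Z x + koszul g X Y' Z x := by
  have h1 : (fun y ↦ g.inner y ((Y + Y') y) (Z y)) =
      fun y ↦ g.inner y (Y y) (Z y) + g.inner y (Y' y) (Z y) := by
    ext y; simp
  have h2 : (fun y ↦ g.inner y (X y) ((Y + Y') y)) =
      fun y ↦ g.inner y (X y) (Y y) + g.inner y (X y) (Y' y) := by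
    ext y; simp
  simp only [koszul, h1, h2, mvfderiv_fun_add (mdiff_inner g hY hZ) (mdiff_inner g hY' hZ),
    mvfderiv_fun_add (mdiff_inner g hX hY) (mdiff_inner g hX hY'), mlieBracket_add_left hY hY',
    mlieBracket_add_right hY hY']
  simp
  ring

theorem koszul_smul (g : RMetric d M) {X Y Z : VF d M} {f : M → ℝ} {x : M}
    (hX : DiffAt X x) (hY : DiffAt Y x) (hZ : DiffAt Z x)
    (hf : MDifferentiableAt (𝓡 d) 𝓘(ℝ, ℝ) f x) :
    koszul g X (f • Y) Z x =
      f x * koszul g X Y Z x + 2 * (mvfderiv (𝓡 d) f x (X x) * g.inner x (Y x) (Z x)) := by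
  have h1 : (fun y ↦ g.inner y ((f • Y) y) (Z y)) = fun y ↦ f y * g.inner y (Y y) (Z y) := by
    ext y; simp
  have h2 : (fun y ↦ g.inner y (X y) ((f • Y) y)) = fun y ↦ f y * g.inner y (X y) (Y y) := by
    ext y; simp
  simp only [koszul, h1, h2, mvfderiv_fun_mul hf (mdiff_inner g hY hZ),
    mvfderiv_fun_mul hf (mdiff_inner g hX hY), mlieBracket_smul_left hf hY,
    mlieBracket_smul_right hf hY]
  simp [g.symm x (Y x) (X x)]
  ring

theorem DiffAt.add {Y Y' : VF d M} {x : M} (hY : DiffAt Y x) (hY' : DiffAt Y' x) :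
    DiffAt (Y + Y') x := mdifferentiableAt_add_section hY hY'

theorem DiffAt.smul {Y : VF d M} {f : M → ℝ} {x : M}
    (hf : MDifferentiableAt (𝓡 d) 𝓘(ℝ, ℝ) f x) (hY : DiffAt Y x) :
    DiffAt (f • Y) x := hf.smul_section hY

/-- The Levi-Civita connection of `g`; `leviCivita g Y x (X x)` is `(∇_X Y)(x)`. By
`leviCivita_torsion` and `leviCivita_metric` it is torsion-free and compatible with `g`. -/
def leviCivita (g : RMetric d M) : CovariantDerivative (𝓡 d) (EuclideanSpace ℝ (Fin d))
    (fun x : M ↦ TangentSpace (𝓡 d) x) where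
  toFun := leviCivitaFun g
  isCovariantDerivativeOnUniv :=
    { add := by
        intro Y Y' x hY hY' _
        ext1 v
        refine eq_of_inner g fun w ↦ ?_
        have hv := mdiff_extend v
        have hw := mdiff_extend w
        rw [← extend_self v, ← extend_self w]
        simp only [add_apply, map_add]
        simp only [leviCivitaFun_koszul g hv (DiffAt.add hY hY') hw,
          leviCivitaFun_koszul g hv hY hw, leviCivitaFun_koszul g hv hY' hw,
          koszul_add g hv hY hY' hw]
        ring
      leibniz := by
        intro Y f x hY hf _
        ext1 v
        refine eq_of_inner g fun w ↦ ?_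
        have hv := mdiff_extend v
        have hw := mdiff_extend w
        rw [← extend_self v, ← extend_self w]
        simp only [add_apply, map_add, smul_apply, map_smul,
          ContinuousLinearMap.smulRight_apply]
        simp only [leviCivitaFun_koszul g hv (DiffAt.smul hf hY) hw,
          leviCivitaFun_koszul g hv hY hw, koszul_smul g hv hY hw hf]
        simp
        ring }

theorem leviCivita_torsion (g : RMetric d M) {X Y : VF d M} {x : M}
    (hX : DiffAt X x) (hY : DiffAt Y x) :
    leviCivita g Y x (X x) - leviCivita g X x (Y x) = mlieBracket (𝓡 d) X Y x := by
  refine eq_of_inner g fun w ↦ ?_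
  have hw := mdiff_extend w
  have hXY : mlieBracket (𝓡 d) Y X x = - mlieBracket (𝓡 d) X Y x := mlieBracket_swap_apply
  rw [← extend_self w]
  set W := FiberBundle.extend (EuclideanSpace ℝ (Fin d)) w
  have h1 := leviCivitaFun_koszul g hX hY hw
  have h2 := leviCivitaFun_koszul g hY hX hw
  have a1 : mlieBracket (𝓡 d) X W x = - mlieBracket (𝓡 d) W X x := mlieBracket_swap_apply
  have a2 : mlieBracket (𝓡 d) Y W x = - mlieBracket (𝓡 d) W Y x := mlieBracket_swap_apply
  have s1 : (fun y ↦ g.inner y (W y) (X y)) = fun y ↦ g.inner y (X y) (W y) := by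
    ext y; exact g.symm ..
  have s2 : (fun y ↦ g.inner y (W y) (Y y)) = fun y ↦ g.inner y (Y y) (W y) := by
    ext y; exact g.symm ..
  have s3 : (fun y ↦ g.inner y (Y y) (X y)) = fun y ↦ g.inner y (X y) (Y y) := by
    ext y; exact g.symm ..
  change g.inner x (leviCivitaFun g Y x (X x) - leviCivitaFun g X x (Y x)) (W x) = _
  rw [map_sub, sub_apply, h1, h2]
  simp only [koszul, hXY, a1, a2, s1, s2, s3, map_neg, neg_apply]
  ring

theorem leviCivita_metric (g : RMetric d M) {X Y Z : VF d M} {x : M}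
    (hX : DiffAt X x) (hY : DiffAt Y x) (hZ : DiffAt Z x) :
    mvfderiv (𝓡 d) (fun y ↦ g.inner y (Y y) (Z y)) x (X x) =
      g.inner x (leviCivita g Y x (X x)) (Z x) + g.inner x (Y x) (leviCivita g Z x (X x)) := by
  have h1 := leviCivitaFun_koszul g hX hY hZ
  have h2 := leviCivitaFun_koszul g hX hZ hY
  have a1 : mlieBracket (𝓡 d) X Z x = - mlieBracket (𝓡 d) Z X x := mlieBracket_swap_apply
  have a2 : mlieBracket (𝓡 d) Y X x = - mlieBracket (𝓡 d) X Y x := mlieBracket_swap_apply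
  have a3 : mlieBracket (𝓡 d) Z Y x = - mlieBracket (𝓡 d) Y Z x := mlieBracket_swap_apply
  have s1 : (fun y ↦ g.inner y (Z y) (X y)) = fun y ↦ g.inner y (X y) (Z y) := by
    ext y; exact g.symm ..
  have s2 : (fun y ↦ g.inner y (Z y) (Y y)) = fun y ↦ g.inner y (Y y) (Z y) := by
    ext y; exact g.symm ..
  have s3 : (fun y ↦ g.inner y (Y y) (X y)) = fun y ↦ g.inner y (X y) (Y y) := by
    ext y; exact g.symm ..
  change _ = g.inner x (leviCivitaFun g Y x (X x)) (Z x) +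
    g.inner x (Y x) (leviCivitaFun g Z x (X x))
  rw [g.symm x (Y x), h1, h2]
  simp only [koszul, a1, a2, a3, s1, s2, s3, map_neg, neg_apply]
  ring

end LeviCivita

section Tensors

variable {d : ℕ} {M : Type*} [TopologicalSpace M] [ChartedSpace (EuclideanSpace ℝ (Fin d)) M]
  [IsManifold (𝓡 d) ∞ M]

/-- A field of endomorphisms of the tangent spaces, i.e. a `(1,1)`-tensor field. -/
abbrev EndField (d : ℕ) (M : Type*) [TopologicalSpace M]
    [ChartedSpace (EuclideanSpace ℝ (Fin d)) M] :=
  Π x : M, TangentSpace (𝓡 d) x →L[ℝ] TangentSpace (𝓡 d) x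

/-- A field of covectors, i.e. a 1-form. -/
abbrev OneForm (d : ℕ) (M : Type*) [TopologicalSpace M]
    [ChartedSpace (EuclideanSpace ℝ (Fin d)) M] :=
  Π x : M, TangentSpace (𝓡 d) x →L[ℝ] ℝ

/-- `X` is a smooth vector field on `M`. -/
def SmoothVF (X : VF d M) : Prop :=
  ContMDiff (𝓡 d) ((𝓡 d).prod 𝓘(ℝ, EuclideanSpace ℝ (Fin d))) ∞
    (fun x ↦ TotalSpace.mk' (EuclideanSpace ℝ (Fin d)) x (X x))

/-- `S` is a smooth `(1,1)`-tensor field on `M`. -/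
def SmoothEnd (S : EndField d M) : Prop :=
  ContMDiff (𝓡 d)
    ((𝓡 d).prod 𝓘(ℝ, EuclideanSpace ℝ (Fin d) →L[ℝ] EuclideanSpace ℝ (Fin d))) ∞
    (fun x ↦ TotalSpace.mk' (EuclideanSpace ℝ (Fin d) →L[ℝ] EuclideanSpace ℝ (Fin d))
      (E := fun x : M ↦ TangentSpace (𝓡 d) x →L[ℝ] TangentSpace (𝓡 d) x) x (S x))

/-- `θ` is a smooth 1-form on `M`. -/
def SmoothForm (θ : OneForm d M) : Prop :=
  ContMDiff (𝓡 d) ((𝓡 d).prod 𝓘(ℝ, EuclideanSpace ℝ (Fin d) →L[ℝ] ℝ)) ∞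
    (fun x ↦ TotalSpace.mk' (EuclideanSpace ℝ (Fin d) →L[ℝ] ℝ)
      (E := fun x : M ↦ TangentSpace (𝓡 d) x →L[ℝ] ℝ) x (θ x))

/-- The vector field `S X`. -/
def app (S : EndField d M) (X : VF d M) : VF d M := fun x ↦ S x (X x)

/-- The Lie bracket `[X, Y]` of vector fields. -/
def bracket (X Y : VF d M) : VF d M := mlieBracket (𝓡 d) X Y

/-- The exterior derivative of a 1-form, in the normalization
`dθ(X, Y) = ½ {X(θ(Y)) - Y(θ(X)) - θ([X, Y])}`. -/
def extDeriv (θ : OneForm d M) (X Y : VF d M) (x : M) : ℝ :=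
  1 / 2 * (mvfderiv (𝓡 d) (fun y ↦ θ y (Y y)) x (X x)
    - mvfderiv (𝓡 d) (fun y ↦ θ y (X y)) x (Y x) - θ x (bracket X Y x))

/-- The Nijenhuis torsion `[S, S](X, Y) = S²[X, Y] + [SX, SY] - S[SX, Y] - S[X, SY]`. -/
def nijenhuis (S : EndField d M) (X Y : VF d M) : VF d M :=
  app S (app S (bracket X Y)) + bracket (app S X) (app S Y)
    - app S (bracket (app S X) Y) - app S (bracket X (app S Y))

/-- The Lie derivative of a `(1,1)`-tensor, `(£_V S) X = [V, SX] - S[V, X]`. -/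
def lieDeriv (V : VF d M) (S : EndField d M) (X : VF d M) : VF d M :=
  bracket V (app S X) - app S (bracket V X)

/-- The Levi-Civita derivative `∇_X Y`. -/
def nabla (g : RMetric d M) (X Y : VF d M) : VF d M := fun x ↦ leviCivita g Y x (X x)

/-- The covariant derivative of a `(1,1)`-tensor, `(∇_X S) Y = ∇_X (SY) - S(∇_X Y)`. -/
def nablaEnd (g : RMetric d M) (X : VF d M) (S : EndField d M) (Y : VF d M) : VF d M :=
  nabla g X (app S Y) - app S (nabla g X Y)

/-- The curvature `R_{X,Y} Z = ∇_X ∇_Y Z - ∇_Y ∇_X Z - ∇_{[X,Y]} Z`. -/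
def curvature (g : RMetric d M) (X Y Z : VF d M) : VF d M :=
  nabla g X (nabla g Y Z) - nabla g Y (nabla g X Z) - nabla g (bracket X Y) Z

end Tensors

section Structures

/-- A framed weak `f`-structure `(f, Q, ξᵢ, ηⁱ)` on a manifold of dimension `2n + s`, with
`f`-invariant contact distribution `⋂ᵢ ker ηⁱ`. -/
structure FramedWeakFStructure (n s : ℕ) (M : Type*) [TopologicalSpace M]
    [ChartedSpace (EuclideanSpace ℝ (Fin (2 * n + s))) M]
    [IsManifold (𝓡 (2 * n + s)) ∞ M] where
  f : EndField (2 * n + s) M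
  Q : EndField (2 * n + s) M
  ξ : Fin s → VF (2 * n + s) M
  η : Fin s → OneForm (2 * n + s) M
  smooth_f : SmoothEnd f
  smooth_Q : SmoothEnd Q
  smooth_ξ : ∀ i, SmoothVF (ξ i)
  smooth_η : ∀ i, SmoothForm (η i)
  rank_f : ∀ x, Module.finrank ℝ (f x).range = 2 * n
  nonsingular_Q : ∀ x, Function.Bijective (Q x)
  f_sq : ∀ x v, f x (f x v) = - Q x v + ∑ i, η i x v • ξ i x
  η_ξ : ∀ x i j, η i x (ξ j x) = if i = j then 1 else 0
  Q_ξ : ∀ x i, Q x (ξ i x) = ξ i x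
  contact_invariant : ∀ x v, (∀ i, η i x v = 0) → ∀ i, η i x (f x v) = 0

/-- A weak metric `f`-structure `(f, Q, ξᵢ, ηⁱ, g)`: a framed weak `f`-structure with a
compatible Riemannian metric. -/
structure WeakMetricFStructure (n s : ℕ) (M : Type*) [TopologicalSpace M]
    [ChartedSpace (EuclideanSpace ℝ (Fin (2 * n + s))) M]
    [IsManifold (𝓡 (2 * n + s)) ∞ M] extends FramedWeakFStructure n s M where
  g : RMetric (2 * n + s) M
  compatible : ∀ x v w,
    g.inner x (f x v) (f x w) = g.inner x v (Q x w) - ∑ i, η i x v * η i x w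

variable {n s : ℕ} {M : Type*} [TopologicalSpace M]
  [ChartedSpace (EuclideanSpace ℝ (Fin (2 * n + s))) M] [IsManifold (𝓡 (2 * n + s)) ∞ M]

/-- Normality: `[f, f] + 2 ∑ᵢ dηⁱ ⊗ ξᵢ = 0`. -/
def FramedWeakFStructure.IsNormal (S : FramedWeakFStructure n s M) : Prop :=
  ∀ X Y, SmoothVF X → SmoothVF Y → ∀ x,
    nijenhuis S.f X Y x + (2 : ℝ) • ∑ i, extDeriv (S.η i) X Y x • S.ξ i x = 0

/-- The tensor `hᵢ = ½ £_{ξᵢ} f`. -/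
def FramedWeakFStructure.h (S : FramedWeakFStructure n s M) (i : Fin s)
    (X : VF (2 * n + s) M) : VF (2 * n + s) M :=
  (1 / 2 : ℝ) • lieDeriv (S.ξ i) S.f X

/-- The 1-form `η̄ = ∑ᵢ ηⁱ`. -/
def FramedWeakFStructure.ηbar (S : FramedWeakFStructure n s M) : OneForm (2 * n + s) M :=
  fun x ↦ ∑ i, S.η i x

/-- `X` is a section of the contact distribution `𝒟 = ⋂ᵢ ker ηⁱ`. -/
def FramedWeakFStructure.InContact (S : FramedWeakFStructure n s M)
    (X : VF (2 * n + s) M) : Prop :=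
  ∀ x i, S.η i x (X x) = 0

namespace WeakMetricFStructure

/-- The fundamental 2-form `Φ(X, Y) = g(X, fY)`. -/
def Φ (S : WeakMetricFStructure n s M) (X Y : VF (2 * n + s) M) (x : M) : ℝ :=
  S.g.inner x (X x) (S.f x (Y x))

/-- Weak almost `𝒮`-structure: `Φ = dη¹ = ⋯ = dηˢ`. -/
def IsWeakAlmostS (S : WeakMetricFStructure n s M) : Prop :=
  ∀ i X Y, SmoothVF X → SmoothVF Y → ∀ x, extDeriv (S.η i) X Y x = S.Φ X Y x

/-- Weak `𝒮`-structure: a normal weak almost `𝒮`-structure. -/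
def IsWeakS (S : WeakMetricFStructure n s M) : Prop :=
  S.IsNormal ∧ S.IsWeakAlmostS

/-- `𝒮`-structure: a weak `𝒮`-structure which is classical, i.e. `Q` is the identity, so that
`f² = -I + ∑ᵢ ηⁱ ⊗ ξᵢ` and `g(fX, fY) = g(X, Y) - ∑ᵢ ηⁱ(X) ηⁱ(Y)`. -/
def IsS (S : WeakMetricFStructure n s M) : Prop :=
  S.IsWeakS ∧ ∀ x v, S.Q x v = v

/-- The `(κ, μ)`-nullity condition
`R_{X,Y} ξᵢ = κ {η̄(X) f²Y - η̄(Y) f²X} + μ {η̄(Y) hᵢX - η̄(X) hᵢY}`. -/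
def Nullity (S : WeakMetricFStructure n s M) (κ μ : ℝ) : Prop :=
  ∀ i X Y, SmoothVF X → SmoothVF Y → ∀ x,
    curvature S.g X Y (S.ξ i) x =
      κ • (S.ηbar x (X x) • S.f x (S.f x (Y x)) - S.ηbar x (Y x) • S.f x (S.f x (X x)))
      + μ • (S.ηbar x (Y x) • S.h i X x - S.ηbar x (X x) • S.h i Y x)

/-- Weak `f`-`(κ, μ)`-manifold: a weak almost `𝒮`-manifold satisfying the `(κ, μ)`-nullity
condition. -/
def IsWeakFKappaMu (S : WeakMetricFStructure n s M) (κ μ : ℝ) : Prop :=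
  S.IsWeakAlmostS ∧ S.Nullity κ μ

/-- The condition `£_{ξᵢ} Q = 0` for all `i`. -/
def LieQZero (S : WeakMetricFStructure n s M) : Prop :=
  ∀ i X, SmoothVF X → ∀ x, lieDeriv (S.ξ i) S.Q X x = 0

/-- The condition `(∇_X Q) Y = 0` for all `X, Y ∈ 𝒟`. -/
def NablaQZero (S : WeakMetricFStructure n s M) : Prop :=
  ∀ X Y, SmoothVF X → SmoothVF Y → S.InContact X → S.InContact Y →
    ∀ x, nablaEnd S.g X S.Q Y x = 0

end WeakMetricFStructure

end Structures

end WeakF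

end

open scoped Manifold ContDiff

/-! Write Aᵢ = ∇ξᵢ + f (`symPart`). Since dηⁱ = Φ forces the skew part of ∇ξᵢ to be -f, Aᵢ is
symmetric, and ξᵢ is Killing exactly when Aᵢ = 0. Both ηʲ and Φ = dηⁱ are invariant along ξᵢ, which
gives hᵢ = -Aᵢf (`h_apply`). With £Q = 0, f² is invariant too, so Aᵢ anticommutes with f
(`f_symPart`) and ∇_{ξᵢ} f = 0.

For κ = 1 the nullity condition on the pair (fX, ξᵢ) is the Riccati equation (∇_{ξᵢ} hᵢ)X = Aᵢ²fX -
μAᵢf²X (`nabla_ξ_h`), without zeroth-order term. Every term anticommutes with f except the quadratic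
one, which commutes, so Aᵢ²f² = 0. Symmetry of Aᵢ then gives Aᵢ = 0 whatever μ is
(`symPart_eq_zero`).

Now ∇_X ξᵢ = -fX and hᵢ = 0. The η-component of (∇_X Q)Y = 0 on 𝒟 reads g(QY - Y, fX) = 0, whence Q
= id (`Q_eq_id`). The curvature condition prescribes (∇_Y f)X - (∇_X f)Y, and skewness of ∇_X f
turns this into a formula for ∇f (`nablaEnd_f`); substituting it in the Nijenhuis torsion gives
normality. -/

open Bundle VectorField
open scoped Manifold ContDiff

noncomputable section

namespace WeakF

/-! ### Smooth vector fields, brackets, derivatives of functions, and the connection. -/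

section Calculus

variable {d : ℕ} {M : Type*} [TopologicalSpace M] [ChartedSpace (EuclideanSpace ℝ (Fin d)) M]
  [IsManifold (𝓡 d) ∞ M]

/-- `φ` is a smooth function on `M`. -/
abbrev SmoothFn (φ : M → ℝ) : Prop := ContMDiff (𝓡 d) 𝓘(ℝ, ℝ) ∞ φ

/-- The derivative `X(φ)` of a function along a vector field. -/
def along (X : VF d M) (φ : M → ℝ) (x : M) : ℝ := mvfderiv (𝓡 d) φ x (X x)

theorem SmoothVF.diffAt {X : VF d M} (hX : SmoothVF X) (x : M) : DiffAt X x :=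
  (hX x).mdifferentiableAt (by simp)

omit [IsManifold (𝓡 d) ∞ M] in
theorem smoothFn_mdiff {φ : M → ℝ} (hφ : SmoothFn (d := d) φ) (x : M) :
    MDifferentiableAt (𝓡 d) 𝓘(ℝ, ℝ) φ x :=
  (hφ x).mdifferentiableAt (by simp)

theorem SmoothVF.sub {X Y : VF d M} (hX : SmoothVF X) (hY : SmoothVF Y) : SmoothVF (X - Y) :=
  ContMDiff.sub_section hX hY

theorem SmoothVF.neg {X : VF d M} (hX : SmoothVF X) : SmoothVF (-X) :=
  ContMDiff.neg_section hX

theorem SmoothVF.smul {X : VF d M} {φ : M → ℝ} (hX : SmoothVF X) (hφ : SmoothFn (d := d) φ) :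
    SmoothVF (φ • X) :=
  ContMDiff.smul_section hφ hX

theorem SmoothVF.const_smul {X : VF d M} (c : ℝ) (hX : SmoothVF X) : SmoothVF (c • X) :=
  ContMDiff.const_smul_section hX

theorem SmoothVF.sum {ι : Type*} {s : Finset ι} {X : ι → VF d M} (hX : ∀ i, SmoothVF (X i)) :
    SmoothVF (fun x ↦ ∑ i ∈ s, X i x) :=
  ContMDiff.sum_section fun i _ ↦ hX i

theorem SmoothVF.app {S : EndField d M} {X : VF d M} (hS : SmoothEnd S) (hX : SmoothVF X) :
    SmoothVF (app S X) :=
  ContMDiff.clm_bundle_apply (F₁ := EuclideanSpace ℝ (Fin d)) (F₂ := EuclideanSpace ℝ (Fin d))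
    hS hX

theorem SmoothVF.bracket {X Y : VF d M} (hX : SmoothVF X) (hY : SmoothVF Y) :
    SmoothVF (bracket X Y) := by
  intro x
  have : IsManifold (𝓡 d) (minSmoothness ℝ 2) M :=
    IsManifold.of_le (n := ∞) (by simpa using! (ENat.LEInfty.out : (2 : WithTop ℕ∞) ≤ ∞))
  have : IsManifold (𝓡 d) ((⊤ : ℕ∞) + 1) M := by simpa using! ‹IsManifold (𝓡 d) ∞ M›
  exact ContMDiffAt.mlieBracket_vectorField (m := ⊤) (n := ⊤) (hX x) (hY x) (by simp)

theorem SmoothForm.apply {θ : OneForm d M} {X : VF d M} (hθ : SmoothForm θ) (hX : SmoothVF X) :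
    SmoothFn (d := d) (fun x ↦ θ x (X x)) := by
  have : ContMDiff (𝓡 d) ((𝓡 d).prod 𝓘(ℝ)) ∞
      (fun m ↦ TotalSpace.mk' ℝ (E := Bundle.Trivial M ℝ) m (θ m (X m))) :=
    ContMDiff.clm_bundle_apply (F₁ := EuclideanSpace ℝ (Fin d)) (F₂ := ℝ) hθ hX
  intro x
  have := this x
  rw [contMDiffAt_section] at this
  exact this

theorem smoothFn_inner (g : RMetric d M) {X Y : VF d M} (hX : SmoothVF X) (hY : SmoothVF Y) :
    SmoothFn (d := d) (fun x ↦ g.inner x (X x) (Y x)) := by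
  have : ContMDiff (𝓡 d) ((𝓡 d).prod 𝓘(ℝ)) ∞
      (fun m ↦ TotalSpace.mk' ℝ (E := Bundle.Trivial M ℝ) m (g.inner m (X m) (Y m))) :=
    ContMDiff.clm_bundle_apply₂ (F₁ := EuclideanSpace ℝ (Fin d))
      (F₂ := EuclideanSpace ℝ (Fin d)) g.contMDiff hX hY
  intro x
  have := this x
  rw [contMDiffAt_section] at this
  exact this

/-- Every tangent vector is the value of a global smooth vector field. -/
theorem exists_smoothVF [T2Space M] (x : M) (v : TangentSpace (𝓡 d) x) :
    ∃ X : VF d M, SmoothVF X ∧ X x = v := by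
  obtain ⟨u, hu, hX⟩ := FiberBundle.exists_contMDiffOn_extend (𝓡 d) (k := ∞)
    (EuclideanSpace ℝ (Fin d)) v
  obtain ⟨t, htu, hto, hxt⟩ := mem_nhds_iff.1 hu
  obtain ⟨φ, -, hφ⟩ := (SmoothBumpFunction.nhds_basis_tsupport (I := 𝓡 d) x).mem_iff.1
    (hto.mem_nhds hxt)
  -- A bump function supported where the local extension is smooth makes it global.
  refine ⟨(φ : M → ℝ) • FiberBundle.extend (EuclideanSpace ℝ (Fin d)) v, ?_, ?_⟩
  · have := ContMDiffOn.smul_section_of_tsupport (n := ∞) (φ.contMDiff.contMDiffOn) hto hφ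
      (hX.mono htu)
    exact this
  · simp

omit [IsManifold (𝓡 d) ∞ M] in
theorem bracket_swap (X Y : VF d M) : bracket Y X = -bracket X Y := mlieBracket_swap

theorem bracket_smul_right {X Y : VF d M} {φ : M → ℝ} (hφ : SmoothFn (d := d) φ)
    (hY : SmoothVF Y) : bracket X (φ • Y) = along X φ • Y + φ • bracket X Y := by
  ext1 x
  exact mlieBracket_smul_right (smoothFn_mdiff hφ x) (hY.diffAt x)

theorem bracket_add_right {X Y Z : VF d M} (hY : SmoothVF Y) (hZ : SmoothVF Z) :
    bracket X (Y + Z) = bracket X Y + bracket X Z := by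
  ext1 x
  exact mlieBracket_add_right (hY.diffAt x) (hZ.diffAt x)

theorem bracket_neg_right {X Y : VF d M} (hY : SmoothVF Y) :
    bracket X (-Y) = -bracket X Y := by
  ext1 x
  have := mlieBracket_const_smul_right (I := 𝓡 d) (V := X) (c := (-1 : ℝ)) (hY.diffAt x)
  simpa [bracket] using this

theorem jacobi {X Y Z : VF d M} (hX : SmoothVF X) (hY : SmoothVF Y) (hZ : SmoothVF Z) :
    bracket X (bracket Y Z) = bracket (bracket X Y) Z + bracket Y (bracket X Z) := by
  have : IsManifold (𝓡 d) (minSmoothness ℝ 3) M := by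
    rw [minSmoothness_of_isRCLikeNormedField]
    exact IsManifold.of_le (n := ∞) (ENat.LEInfty.out)
  have h2 : minSmoothness ℝ 2 ≤ (∞ : WithTop ℕ∞) := by simpa using! (ENat.LEInfty.out : (2 : WithTop ℕ∞) ≤ ∞)
  exact leibniz_identity_mlieBracket (ContMDiff.of_le hX h2) (ContMDiff.of_le hY h2)
    (ContMDiff.of_le hZ h2)

omit [IsManifold (𝓡 d) ∞ M] in
theorem along_sub {X : VF d M} {φ ψ : M → ℝ} (hφ : SmoothFn (d := d) φ)
    (hψ : SmoothFn (d := d) ψ) (x : M) :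
    along X (fun y ↦ φ y - ψ y) x = along X φ x - along X ψ x := by
  simp [along, mvfderiv_fun_sub (smoothFn_mdiff hφ x) (smoothFn_mdiff hψ x)]

omit [IsManifold (𝓡 d) ∞ M] in
theorem along_const (X : VF d M) (c : ℝ) (x : M) : along X (fun _ ↦ c) x = 0 := by
  simp [along, mvfderiv_const]

omit [IsManifold (𝓡 d) ∞ M] in
theorem along_const_mul {X : VF d M} {φ : M → ℝ} (hφ : SmoothFn (d := d) φ) (c : ℝ) (x : M) :
    along X (fun y ↦ c * φ y) x = c * along X φ x := by
  have := mvfderiv_fun_mul (mdifferentiableAt_const (c := c)) (smoothFn_mdiff hφ x)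
  simp [along, this, mvfderiv_const]

variable (g : RMetric d M)

theorem nabla_add {X Y Z : VF d M} {x : M} (hY : SmoothVF Y) (hZ : SmoothVF Z) :
    nabla g X (Y + Z) x = nabla g X Y x + nabla g X Z x := by
  have := (leviCivita g).isCovariantDerivativeOnUniv.add (hY.diffAt x) (hZ.diffAt x)
  exact congr($this (X x))

theorem nabla_smul {X Y : VF d M} {φ : M → ℝ} {x : M} (hφ : SmoothFn (d := d) φ)
    (hY : SmoothVF Y) :
    nabla g X (φ • Y) x = φ x • nabla g X Y x + along X φ x • Y x := by
  have := (leviCivita g).isCovariantDerivativeOnUniv.leibniz (hY.diffAt x) (smoothFn_mdiff hφ x)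
  exact congr($this (X x))

theorem nabla_const_smul {X Y : VF d M} {x : M} (c : ℝ) (hY : SmoothVF Y) :
    nabla g X (c • Y) x = c • nabla g X Y x := by
  have := nabla_smul g (X := X) (φ := fun _ ↦ c) (x := x) contMDiff_const hY
  rwa [along_const, zero_smul, add_zero] at this

theorem nabla_neg {X Y : VF d M} {x : M} (hY : SmoothVF Y) :
    nabla g X (-Y) x = -nabla g X Y x := by
  simpa using nabla_const_smul g (X := X) (x := x) (-1) hY

theorem nabla_sub {X Y Z : VF d M} {x : M} (hY : SmoothVF Y) (hZ : SmoothVF Z) :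
    nabla g X (Y - Z) x = nabla g X Y x - nabla g X Z x := by
  rw [sub_eq_add_neg, nabla_add g hY hZ.neg, nabla_neg g hZ, sub_eq_add_neg]

theorem nabla_zero (X : VF d M) (x : M) : nabla g X 0 x = 0 := by
  simp [nabla]

theorem bracket_eq_nabla {X Y : VF d M} (hX : SmoothVF X) (hY : SmoothVF Y) (x : M) :
    bracket X Y x = nabla g X Y x - nabla g Y X x :=
  (leviCivita_torsion g (hX.diffAt x) (hY.diffAt x)).symm

theorem along_inner {X Y Z : VF d M} (hX : SmoothVF X) (hY : SmoothVF Y) (hZ : SmoothVF Z)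
    (x : M) :
    along X (fun y ↦ g.inner y (Y y) (Z y)) x =
      g.inner x (nabla g X Y x) (Z x) + g.inner x (Y x) (nabla g X Z x) :=
  leviCivita_metric g (hX.diffAt x) (hY.diffAt x) (hZ.diffAt x)

theorem eq_zero_of_inner_self {x : M} {v : TangentSpace (𝓡 d) x} (h : g.inner x v v = 0) :
    v = 0 := by
  by_contra hv
  exact (g.pos x v hv).ne' h

/-- If some smooth 1-form takes the constant value `1` on a smooth vector field, then the
derivative of a smooth function along a smooth vector field is smooth. -/
theorem smoothFn_along {θ : OneForm d M} {Z : VF d M} (hθ : SmoothForm θ)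
    (hZ : SmoothVF Z) (h1 : ∀ x, θ x (Z x) = 1) {X : VF d M} {φ : M → ℝ} (hX : SmoothVF X)
    (hφ : SmoothFn (d := d) φ) : SmoothFn (d := d) (along X φ) := by
  -- The Leibniz rule for [X, φZ] expresses Xφ through brackets, already known to be smooth.
  have h : along X φ = fun x ↦ θ x (bracket X (φ • Z) x) - φ x * θ x (bracket X Z x) := by
    ext x
    simp [bracket_smul_right hφ hZ, h1]
  rw [h]
  exact (hθ.apply (hX.bracket (hZ.smul hφ))).sub (hφ.mul (hθ.apply (hX.bracket hZ)))

/-- The Lie bracket acts on functions as a commutator. -/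
theorem along_bracket {θ : OneForm d M} {Z : VF d M} (hθ : SmoothForm θ)
    (hZ : SmoothVF Z) (h1 : ∀ x, θ x (Z x) = 1) {X Y : VF d M} {φ : M → ℝ} (hX : SmoothVF X)
    (hY : SmoothVF Y) (hφ : SmoothFn (d := d) φ) (x : M) :
    along (bracket X Y) φ x = along X (along Y φ) x - along Y (along X φ) x := by
  have hXφ := smoothFn_along hθ hZ h1 hX hφ
  have hYφ := smoothFn_along hθ hZ h1 hY hφ
  -- Jacobi for φZ minus φ times Jacobi for Z: the terms with a single derivative of φ cancel, and
  -- θ(Z) = 1 isolates the second-order ones.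
  have e1 := congr(θ x ($(jacobi hX hY (hZ.smul hφ)) x))
  have e2 := congr(θ x ($(jacobi hX hY hZ) x))
  rw [bracket_smul_right hφ hZ, bracket_smul_right hφ hZ, bracket_smul_right hφ hZ,
    bracket_add_right (hZ.smul hYφ) ((hY.bracket hZ).smul hφ),
    bracket_add_right (hZ.smul hXφ) ((hX.bracket hZ).smul hφ),
    bracket_smul_right hYφ hZ, bracket_smul_right hXφ hZ,
    bracket_smul_right hφ (hX.bracket hZ), bracket_smul_right hφ (hY.bracket hZ)] at e1
  simp only [Pi.add_apply, Pi.smul_apply', map_add, map_smul, smul_eq_mul, h1] at e1 e2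
  linear_combination φ x * e2 - e1

end Calculus

/-! ### Algebra of the structure tensors, and invariance of ηʲ and Φ along ξᵢ. -/

namespace WeakMetricFStructure

variable {n s : ℕ} {M : Type*} [TopologicalSpace M] [T2Space M]
  [ChartedSpace (EuclideanSpace ℝ (Fin (2 * n + s))) M] [IsManifold (𝓡 (2 * n + s)) ∞ M]
  {S : WeakMetricFStructure n s M}

omit [T2Space M] [IsManifold (𝓡 (2 * n + s)) ∞ M] in
theorem extDeriv_swap (θ : OneForm (2 * n + s) M) (X Y : VF (2 * n + s) M) (x : M) :
    extDeriv θ Y X x = -extDeriv θ X Y x := by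
  simp only [extDeriv, bracket_swap X Y, Pi.neg_apply, map_neg]
  ring

/-- Φ is skew because it is an exterior derivative; `hs` provides a form ηⁱ to differentiate. -/
theorem inner_f_swap (hA : S.IsWeakAlmostS) (hs : 0 < s) (x : M)
    (v w : TangentSpace (𝓡 (2 * n + s)) x) :
    S.g.inner x (S.f x v) w = -S.g.inner x v (S.f x w) := by
  obtain ⟨X, hX, rfl⟩ := exists_smoothVF x v
  obtain ⟨Y, hY, rfl⟩ := exists_smoothVF x w
  have h1 := hA ⟨0, hs⟩ X Y hX hY x
  have h2 := hA ⟨0, hs⟩ Y X hY hX x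
  rw [extDeriv_swap, h1] at h2
  simp only [Φ] at h2
  rw [S.g.symm x (S.f x (X x)), h2]

omit [T2Space M] in
theorem f_f_ξ (S : WeakMetricFStructure n s M) (x : M) (j : Fin s) :
    S.f x (S.f x (S.ξ j x)) = 0 := by
  simp [S.f_sq, S.η_ξ, S.Q_ξ]

/-- By skewness |fξⱼ|² = -g(ξⱼ, f²ξⱼ) = 0. -/
theorem f_ξ (hA : S.IsWeakAlmostS) (x : M) (j : Fin s) : S.f x (S.ξ j x) = 0 := by
  apply eq_zero_of_inner_self S.g
  rw [inner_f_swap hA j.pos, f_f_ξ, map_zero, neg_zero]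

theorem inner_ξ (hA : S.IsWeakAlmostS) (x : M) (j : Fin s)
    (v : TangentSpace (𝓡 (2 * n + s)) x) : S.g.inner x v (S.ξ j x) = S.η j x v := by
  have := S.compatible x v (S.ξ j x)
  simp [f_ξ hA, S.Q_ξ, S.η_ξ] at this
  linarith

omit [T2Space M] in
theorem inner_Q_swap (S : WeakMetricFStructure n s M) (x : M)
    (v w : TangentSpace (𝓡 (2 * n + s)) x) :
    S.g.inner x (S.Q x v) w = S.g.inner x v (S.Q x w) := by
  have h1 := S.compatible x v w
  have h2 := S.compatible x w v
  have h3 : ∑ i, S.η i x v * S.η i x w = ∑ i, S.η i x w * S.η i x v := by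
    simp only [mul_comm]
  rw [S.g.symm x (S.f x w)] at h2
  rw [S.g.symm x (S.Q x v)]
  linarith

theorem η_Q (hA : S.IsWeakAlmostS) (x : M) (j : Fin s)
    (v : TangentSpace (𝓡 (2 * n + s)) x) : S.η j x (S.Q x v) = S.η j x v := by
  rw [← inner_ξ hA, ← inner_ξ hA, inner_Q_swap, S.Q_ξ]

theorem η_f (hA : S.IsWeakAlmostS) (x : M) (j : Fin s)
    (v : TangentSpace (𝓡 (2 * n + s)) x) : S.η j x (S.f x v) = 0 := by
  rw [← inner_ξ hA, inner_f_swap hA j.pos, f_ξ hA, map_zero, neg_zero]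

/-- Compute f³ as f·f² and as f²·f; the terms in ξᵢ vanish in both. -/
theorem f_Q (hA : S.IsWeakAlmostS) (x : M) (v : TangentSpace (𝓡 (2 * n + s)) x) :
    S.f x (S.Q x v) = S.Q x (S.f x v) := by
  have h1 := congr(S.f x $(S.f_sq x v))
  rw [S.f_sq x (S.f x v)] at h1
  simpa [η_f hA, f_ξ hA] using h1.symm

omit [T2Space M] in
theorem eq_zero_of_f_eq_zero (S : WeakMetricFStructure n s M) {x : M}
    {v : TangentSpace (𝓡 (2 * n + s)) x} (hf : S.f x v = 0) (hη : ∀ i, S.η i x v = 0) :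
    v = 0 := by
  have := S.f_sq x v
  simp [hf, hη] at this
  exact (S.nonsingular_Q x).1 (this.trans (map_zero (S.Q x)).symm)

/-- The forms `ηʲ` are invariant under the flows of the `ξᵢ`. -/
theorem η_bracket_ξ (hA : S.IsWeakAlmostS) (i j : Fin s) {X : VF (2 * n + s) M}
    (hX : SmoothVF X) (x : M) :
    S.η j x (bracket (S.ξ i) X x) = along (S.ξ i) (fun y ↦ S.η j y (X y)) x := by
  have h := hA j (S.ξ i) X (S.smooth_ξ i) hX x
  have h1 : mvfderiv (𝓡 (2 * n + s)) (fun y ↦ S.η j y (S.ξ i y)) x (X x) = 0 := by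
    simp only [S.η_ξ]
    exact along_const X _ x
  -- Since fξᵢ = 0, the contraction of dηʲ = Φ with ξᵢ vanishes; this is Cartan's formula for £_{ξᵢ}
  -- ηʲ.
  rw [Φ, S.g.symm, inner_f_swap hA j.pos, f_ξ hA, map_zero, neg_zero, extDeriv, h1] at h
  simp only [along]
  linarith

theorem η_bracket_ξ_ξ (hA : S.IsWeakAlmostS) (i j k : Fin s) (x : M) :
    S.η k x (bracket (S.ξ i) (S.ξ j) x) = 0 := by
  rw [η_bracket_ξ hA i k (S.smooth_ξ j)]
  simp only [S.η_ξ]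
  exact along_const _ _ x

theorem η_bracket_ξ_app_f (hA : S.IsWeakAlmostS) (i j : Fin s) {X : VF (2 * n + s) M}
    (hX : SmoothVF X) (x : M) : S.η j x (bracket (S.ξ i) (app S.f X) x) = 0 := by
  rw [η_bracket_ξ hA i j (hX.app S.smooth_f)]
  simp only [app, η_f hA]
  exact along_const _ _ x

/-- The fundamental form is invariant under the flows of the `ξᵢ`. -/
theorem along_ξ_Φ (hA : S.IsWeakAlmostS) (i : Fin s) {X Y : VF (2 * n + s) M}
    (hX : SmoothVF X) (hY : SmoothVF Y) (x : M) :
    along (S.ξ i) (S.Φ X Y) x =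
      S.g.inner x (bracket (S.ξ i) X x) (S.f x (Y x)) +
        S.g.inner x (X x) (S.f x (bracket (S.ξ i) Y x)) := by
  have hξ := S.smooth_ξ i
  have hη := S.smooth_η i
  have h1 : ∀ x, S.η i x (S.ξ i x) = 1 := by simp [S.η_ξ]
  have d1 := fun X Y hX hY ↦ funext (hA i X Y hX hY)
  have e1 := congrFun (d1 _ _ (hξ.bracket hX) hY) x
  have e2 := congrFun (d1 _ _ hX (hξ.bracket hY)) x
  have sX := hη.apply hX
  have sY := hη.apply hY
  have sm := fun {X φ} ↦ smoothFn_along hη hξ h1 (X := X) (φ := φ)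
  have hfun : S.Φ X Y = fun y ↦ 1 / 2 * ((along X (fun y ↦ S.η i y (Y y)) y
      - along Y (fun y ↦ S.η i y (X y)) y) - S.η i y (bracket X Y y)) :=
    (d1 X Y hX hY).symm
  -- What follows is £_{ξᵢ} dηⁱ = d £_{ξᵢ} ηⁱ = 0 written out: commutators on the functions ηⁱ(X),
  -- ηⁱ(Y), and the Jacobi identity for the bracket term.
  have c1 := along_bracket hη hξ h1 hξ hX sY x
  have c2 := along_bracket hη hξ h1 hξ hY sX x
  have j1 := congr(S.η i x ($(jacobi hξ hX hY) x))
  have l1 : (fun y ↦ S.η i y (bracket (S.ξ i) X y)) =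
      along (S.ξ i) (fun y ↦ S.η i y (X y)) := funext (η_bracket_ξ hA i i hX)
  have l2 : (fun y ↦ S.η i y (bracket (S.ξ i) Y y)) =
      along (S.ξ i) (fun y ↦ S.η i y (Y y)) := funext (η_bracket_ξ hA i i hY)
  have l3 := η_bracket_ξ hA i i (hX.bracket hY) x
  rw [hfun, along_const_mul (((sm hX sY).sub (sm hY sX)).sub (hη.apply (hX.bracket hY))),
    along_sub ((sm hX sY).sub (sm hY sX)) (hη.apply (hX.bracket hY)),
    along_sub (sm hX sY) (sm hY sX)]
  simp only [Φ, extDeriv, l1, l2] at e1 e2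
  simp only [along, Pi.add_apply, map_add] at *
  linarith

end WeakMetricFStructure

/-! ### Brackets with finite sums. -/

section Calculus

variable {d : ℕ} {M : Type*} [TopologicalSpace M] [ChartedSpace (EuclideanSpace ℝ (Fin d)) M]
  [IsManifold (𝓡 d) ∞ M]

omit [IsManifold (𝓡 d) ∞ M] in
theorem bracket_zero_right (X : VF d M) : bracket X 0 = 0 := mlieBracket_zero_right

theorem bracket_sum_right {ι : Type*} (t : Finset ι) (X : VF d M) {Y : ι → VF d M}
    (hY : ∀ i, SmoothVF (Y i)) (x : M) :
    bracket X (fun y ↦ ∑ i ∈ t, Y i y) x = ∑ i ∈ t, bracket X (Y i) x := by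
  classical
  induction t using Finset.induction_on with
  | empty =>
    simp only [Finset.sum_empty]
    exact congrFun (bracket_zero_right X) x
  | insert a t ha ih =>
    simp only [Finset.sum_insert ha]
    rw [← ih]
    exact congrFun (bracket_add_right (hY a) (SmoothVF.sum hY)) x

end Calculus

/-! ### The symmetric part of ∇ξᵢ and its vanishing. -/

namespace WeakMetricFStructure

variable {n s : ℕ} {M : Type*} [TopologicalSpace M] [T2Space M]
  [ChartedSpace (EuclideanSpace ℝ (Fin (2 * n + s))) M] [IsManifold (𝓡 (2 * n + s)) ∞ M]
  {S : WeakMetricFStructure n s M}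

/-- The symmetric part `∇ξᵢ + f` of the endomorphism `∇ξᵢ`. -/
def symPart (S : WeakMetricFStructure n s M) (i : Fin s) : EndField (2 * n + s) M :=
  fun x ↦ leviCivita S.g (S.ξ i) x + S.f x

omit [T2Space M] in
theorem nabla_ξ (S : WeakMetricFStructure n s M) (i : Fin s) (X : VF (2 * n + s) M) (x : M) :
    nabla S.g X (S.ξ i) x = S.symPart i x (X x) - S.f x (X x) := by
  simp [symPart, nabla]

/-- With ηⁱ = g(·, ξᵢ), dηⁱ is the skew part of ∇ξᵢ up to sign, and dηⁱ = Φ identifies that part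
with -f. -/
theorem inner_symPart_swap (hA : S.IsWeakAlmostS) (i : Fin s) (x : M)
    (v w : TangentSpace (𝓡 (2 * n + s)) x) :
    S.g.inner x (S.symPart i x v) w = S.g.inner x v (S.symPart i x w) := by
  obtain ⟨X, hX, rfl⟩ := exists_smoothVF x v
  obtain ⟨Y, hY, rfl⟩ := exists_smoothVF x w
  have h := hA i X Y hX hY x
  have e1 := along_inner S.g hX hY (S.smooth_ξ i) x
  have e2 := along_inner S.g hY hX (S.smooth_ξ i) x
  simp only [inner_ξ hA] at e1 e2
  rw [extDeriv, bracket_eq_nabla S.g hX hY] at h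
  rw [nabla_ξ] at e1 e2
  simp only [along] at e1 e2
  rw [e1, e2] at h
  simp only [map_sub, Φ] at h
  rw [S.g.symm x (S.symPart i x (X x))]
  rw [S.g.symm x (Y x) (S.f x (X x)), inner_f_swap hA i.pos] at h
  linarith

/-- Invariance of Φ = g(·, f·) trades £_{ξᵢ} f for -£_{ξᵢ} g composed with f, and £_{ξᵢ} g is twice
the form of the symmetric part of ∇ξᵢ. -/
theorem h_apply (hA : S.IsWeakAlmostS) (i : Fin s) {X : VF (2 * n + s) M} (hX : SmoothVF X)
    (x : M) : S.h i X x = -S.symPart i x (S.f x (X x)) := by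
  refine eq_of_inner S.g fun w ↦ ?_
  obtain ⟨W, hW, rfl⟩ := exists_smoothVF x w
  have hξ := S.smooth_ξ i
  have hfX := hX.app S.smooth_f
  have e := along_ξ_Φ hA i hW hX x
  have e1 := along_inner S.g hξ hW hfX x
  have e2 := bracket_eq_nabla S.g hξ hW x
  have e3 := bracket_eq_nabla S.g hξ hfX x
  rw [nabla_ξ] at e2 e3
  rw [show along (S.ξ i) (S.Φ W X) x = _ from e1, e2] at e
  have e4 : S.h i X x = (1 / 2 : ℝ) •
      (bracket (S.ξ i) (app S.f X) x - S.f x (bracket (S.ξ i) X x)) := rfl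
  have s1 := inner_symPart_swap hA i x (W x) (S.f x (X x))
  have s2 := inner_f_swap hA i.pos x (W x) (S.f x (X x))
  rw [S.g.symm x (S.h i X x), S.g.symm x (-S.symPart i x (S.f x (X x))), e4, e3]
  simp only [app, map_sub, map_smul, map_neg, sub_apply, smul_eq_mul] at e ⊢
  linarith

omit [T2Space M] in
theorem smoothVF_h {X : VF (2 * n + s) M} (hX : SmoothVF X) (i : Fin s) :
    SmoothVF (S.h i X) :=
  (((S.smooth_ξ i).bracket (hX.app S.smooth_f)).sub
    (((S.smooth_ξ i).bracket hX).app S.smooth_f)).const_smul _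

omit [T2Space M] in
theorem two_smul_h (S : WeakMetricFStructure n s M) (i : Fin s) (X : VF (2 * n + s) M) (x : M) :
    (2 : ℝ) • S.h i X x =
      bracket (S.ξ i) (app S.f X) x - S.f x (bracket (S.ξ i) X x) := by
  change (2 : ℝ) • (1 / 2 : ℝ) • lieDeriv (S.ξ i) S.f X x = lieDeriv (S.ξ i) S.f X x
  rw [smul_smul]
  norm_num

theorem η_h (hA : S.IsWeakAlmostS) (i j : Fin s) {X : VF (2 * n + s) M} (hX : SmoothVF X)
    (x : M) : S.η j x (S.h i X x) = 0 := by
  have := congr(S.η j x $(two_smul_h S i X x))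
  simpa [η_bracket_ξ_app_f hA i j hX, η_f hA] using this

/-- Because fξⱼ = 0, f[ξᵢ, ξⱼ] = -2hᵢξⱼ, which vanishes by `h_apply`; the η-components vanish by
invariance. -/
theorem bracket_ξ_ξ (hA : S.IsWeakAlmostS) (i j : Fin s) : bracket (S.ξ i) (S.ξ j) = 0 := by
  ext1 x
  refine eq_zero_of_f_eq_zero S ?_ fun k ↦ η_bracket_ξ_ξ hA i j k x
  have e := two_smul_h S i (S.ξ j) x
  have : app S.f (S.ξ j) = 0 := funext fun y ↦ f_ξ hA y j
  rw [h_apply hA i (S.smooth_ξ j), f_ξ hA, this, bracket_zero_right] at e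
  simpa using e.symm

/-- The image of hᵢ lies in 𝒟, which by symmetry kills fAᵢξⱼ. The coefficients ηᵏ(Aᵢξⱼ) are totally
symmetric in i, j, k, yet skew in i, k since g(ξᵢ, ξₖ) is constant, so they vanish. -/
theorem symPart_ξ (hA : S.IsWeakAlmostS) (i j : Fin s) (x : M) :
    S.symPart i x (S.ξ j x) = 0 := by
  refine eq_zero_of_f_eq_zero S ?_ fun k ↦ ?_
  · refine eq_of_inner S.g fun w ↦ ?_
    obtain ⟨W, hW, rfl⟩ := exists_smoothVF x w
    have := η_h hA i j hW x
    rw [h_apply hA i hW, map_neg, neg_eq_zero, ← inner_ξ hA, S.g.symm,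
      ← inner_symPart_swap hA] at this
    simp [inner_f_swap hA i.pos, this]
  · have sym12 : ∀ i j k, S.η k x (S.symPart i x (S.ξ j x)) =
        S.η k x (S.symPart j x (S.ξ i x)) := fun i j k ↦ by
      have := bracket_eq_nabla S.g (S.smooth_ξ i) (S.smooth_ξ j) x
      rw [bracket_ξ_ξ hA, nabla_ξ, nabla_ξ, f_ξ hA, f_ξ hA] at this
      simp only [Pi.zero_apply, sub_zero] at this
      rw [sub_eq_zero.1 this.symm]
    have sym23 : ∀ i j k, S.η k x (S.symPart i x (S.ξ j x)) =
        S.η j x (S.symPart i x (S.ξ k x)) := fun i j k ↦ by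
      rw [← inner_ξ hA, inner_symPart_swap hA, S.g.symm, inner_ξ hA]
    have skew : S.η k x (S.symPart i x (S.ξ j x)) + S.η i x (S.symPart k x (S.ξ j x)) = 0 := by
      have := along_inner S.g (S.smooth_ξ j) (S.smooth_ξ i) (S.smooth_ξ k) x
      simp only [inner_ξ hA, S.η_ξ, nabla_ξ, f_ξ hA, sub_zero] at this
      rw [along_const, S.g.symm x (S.ξ i x), inner_ξ hA] at this
      exact this.symm
    have e1 := sym12 i j k
    have e2 := sym23 j i k
    have e3 := sym12 j k i
    linarith

/-- Differentiate f² = -Q + ∑ ηʲ ⊗ ξⱼ along ξᵢ: the right side is invariant, so hᵢf + fhᵢ = 0. -/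
theorem symPart_f_f (hA : S.IsWeakAlmostS) (hL : S.LieQZero) (i : Fin s) (x : M)
    (v : TangentSpace (𝓡 (2 * n + s)) x) :
    S.symPart i x (S.f x (S.f x v)) = -S.f x (S.symPart i x (S.f x v)) := by
  obtain ⟨X, hX, rfl⟩ := exists_smoothVF x v
  have hξ := S.smooth_ξ i
  have hfX := hX.app S.smooth_f
  have hQX := hX.app S.smooth_Q
  have sm : ∀ j, SmoothVF ((fun y ↦ S.η j y (X y)) • S.ξ j) := fun j ↦
    (S.smooth_ξ j).smul ((S.smooth_η j).apply hX)
  have hff : app S.f (app S.f X) =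
      -app S.Q X + fun y ↦ ∑ j, ((fun y ↦ S.η j y (X y)) • S.ξ j) y :=
    funext fun y ↦ S.f_sq y (X y)
  have e1 := two_smul_h S i (app S.f X) x
  have e2 := congr(S.f x $(two_smul_h S i X x))
  have e3 : bracket (S.ξ i) (app S.Q X) x = S.Q x (bracket (S.ξ i) X x) :=
    sub_eq_zero.1 (hL i X hX x)
  -- Invariance of f²: Q by `hL`, ηʲ by `η_bracket_ξ`, ξⱼ by commutation.
  have e4 : bracket (S.ξ i) (app S.f (app S.f X)) x =
      S.f x (S.f x (bracket (S.ξ i) X x)) := by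
    rw [hff, bracket_add_right hQX.neg (SmoothVF.sum sm), bracket_neg_right hQX, S.f_sq,
      Pi.add_apply, Pi.neg_apply, e3, bracket_sum_right _ _ sm]
    congr 1
    refine Finset.sum_congr rfl fun j _ ↦ ?_
    rw [bracket_smul_right ((S.smooth_η j).apply hX) (S.smooth_ξ j), bracket_ξ_ξ hA,
      η_bracket_ξ hA i j hX]
    simp
  rw [h_apply hA i hfX, e4] at e1
  rw [h_apply hA i hX, map_sub] at e2
  simp only [app, map_smul, map_neg] at e1 e2
  have : (2 : ℝ) • (S.symPart i x (S.f x (S.f x (X x))) + S.f x (S.symPart i x (S.f x (X x))))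
      = 0 := by
    linear_combination (norm := module) -e1 - e2
  rw [smul_eq_zero_iff_right two_ne_zero] at this
  exact eq_neg_of_add_eq_zero_left this

/-- Every tangent vector is the sum of a vector in the image of `f²` and of a combination of
the `ξᵢ`. -/
theorem exists_eq_f_f_add (hA : S.IsWeakAlmostS) (x : M)
    (v : TangentSpace (𝓡 (2 * n + s)) x) :
    ∃ u, v = S.f x (S.f x u) + ∑ i, S.η i x v • S.ξ i x := by
  obtain ⟨u, rfl⟩ := (S.nonsingular_Q x).2 v
  -- With v = Qu, f²(-u) = Qu - ∑ ηⁱ(u)ξᵢ and ηⁱ(Qu) = ηⁱ(u).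
  refine ⟨-u, ?_⟩
  simp [η_Q hA, S.f_sq]

theorem f_symPart (hA : S.IsWeakAlmostS) (hL : S.LieQZero) (i : Fin s) (x : M)
    (v : TangentSpace (𝓡 (2 * n + s)) x) :
    S.f x (S.symPart i x v) = -S.symPart i x (S.f x v) := by
  obtain ⟨u, hu⟩ := exists_eq_f_f_add hA x v
  rw [hu]
  simp [symPart_ξ hA, f_ξ hA, symPart_f_f hA hL i x (S.f x u)]

/-- The tensor `f` is parallel along the `ξᵢ`. -/
theorem nabla_ξ_app_f (hA : S.IsWeakAlmostS) (hL : S.LieQZero) (i : Fin s)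
    {X : VF (2 * n + s) M} (hX : SmoothVF X) (x : M) :
    nabla S.g (S.ξ i) (app S.f X) x = S.f x (nabla S.g (S.ξ i) X x) := by
  have hξ := S.smooth_ξ i
  have e := two_smul_h S i X x
  -- Expanding the brackets leaves (∇_{ξᵢ} f)X plus the commutator of f and Aᵢ; by anticommutation
  -- the latter is -2AᵢfX, already equal to 2hᵢX.
  rw [h_apply hA i hX, bracket_eq_nabla S.g hξ (hX.app S.smooth_f),
    bracket_eq_nabla S.g hξ hX, nabla_ξ, nabla_ξ, map_sub, map_sub, f_symPart hA hL] at e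
  simp only [app] at e ⊢
  linear_combination (norm := module) -e

theorem nabla_ξ_ξ (hA : S.IsWeakAlmostS) (i j : Fin s) : nabla S.g (S.ξ i) (S.ξ j) = 0 := by
  ext1 x
  simp [nabla_ξ, symPart_ξ hA, f_ξ hA]

theorem nabla_app_f_ξ (hA : S.IsWeakAlmostS) (i : Fin s) {X : VF (2 * n + s) M}
    (hX : SmoothVF X) :
    nabla S.g (app S.f X) (S.ξ i) = -app S.f (app S.f X) - S.h i X := by
  ext1 x
  simp only [nabla_ξ, h_apply hA i hX, app, Pi.sub_apply, Pi.neg_apply]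
  abel

omit [T2Space M] in
theorem ηbar_ξ (S : WeakMetricFStructure n s M) (i : Fin s) (x : M) :
    S.ηbar x (S.ξ i x) = 1 := by
  simp [FramedWeakFStructure.ηbar, S.η_ξ]

theorem ηbar_f (hA : S.IsWeakAlmostS) (x : M) (v : TangentSpace (𝓡 (2 * n + s)) x) :
    S.ηbar x (S.f x v) = 0 := by
  simp [FramedWeakFStructure.ηbar, η_f hA]

/-- The Riccati-type equation for `h` along `ξᵢ`. -/
theorem nabla_ξ_h {μ : ℝ} (hS : S.IsWeakFKappaMu 1 μ) (hL : S.LieQZero) (i : Fin s)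
    {X : VF (2 * n + s) M} (hX : SmoothVF X) (x : M) :
    nabla S.g (S.ξ i) (S.h i X) x + S.symPart i x (S.f x (nabla S.g (S.ξ i) X x)) =
      S.symPart i x (S.symPart i x (S.f x (X x)))
        - μ • S.symPart i x (S.f x (S.f x (X x))) := by
  have hA := hS.1
  have hξ := S.smooth_ξ i
  have hfX := hX.app S.smooth_f
  have hffX := hfX.app S.smooth_f
  -- The f³X coming from ∇ξᵢ applied twice cancels the one in the nullity condition exactly because
  -- κ = 1.
  have e := hS.2 i (app S.f X) (S.ξ i) hfX hξ x
  rw [curvature, nabla_ξ_ξ hA, nabla_app_f_ξ hA i hX, h_apply hA i hfX,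
    h_apply hA i hξ] at e
  simp only [Pi.sub_apply, nabla_zero, nabla_sub S.g hffX.neg (smoothVF_h hX i),
    nabla_neg S.g hffX, nabla_ξ_app_f hA hL i hX, nabla_ξ_app_f hA hL i hfX, nabla_ξ,
    bracket_eq_nabla S.g hfX hξ] at e
  simp only [app, map_sub, f_symPart hA hL, ηbar_ξ, ηbar_f hA, f_ξ hA, map_zero] at e
  linear_combination (norm := module) e

/-- The vector fields `ξᵢ` are Killing. -/
theorem symPart_eq_zero {μ : ℝ} (hS : S.IsWeakFKappaMu 1 μ) (hL : S.LieQZero) (i : Fin s)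
    (x : M) (v : TangentSpace (𝓡 (2 * n + s)) x) : S.symPart i x v = 0 := by
  have hA := hS.1
  have key : ∀ u, S.symPart i x (S.f x (S.f x u)) = 0 := fun u ↦ by
    obtain ⟨X, hX, rfl⟩ := exists_smoothVF x u
    have hfX := hX.app S.smooth_f
    have hhf : S.h i (app S.f X) = -app S.f (S.h i X) := by
      ext1 y
      simp [h_apply hA i hX, h_apply hA i hfX, app, f_symPart hA hL]
    -- Apply f to the Riccati equation and compare with the equation at fX: in the sum only 2Aᵢ²f²X
    -- survives.
    have e1 := congr(S.f x $(nabla_ξ_h hS hL i hX x))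
    have e2 := nabla_ξ_h hS hL i hfX x
    rw [hhf, nabla_neg S.g ((smoothVF_h hX i).app S.smooth_f),
      nabla_ξ_app_f hA hL i (smoothVF_h hX i), nabla_ξ_app_f hA hL i hX] at e2
    simp only [app, map_add, map_sub, map_smul, map_neg, f_symPart hA hL] at e1 e2
    have e3 : (2 : ℝ) • S.symPart i x (S.symPart i x (S.f x (S.f x (X x)))) = 0 := by
      linear_combination (norm := module) -e1 - e2
    rw [smul_eq_zero_iff_right two_ne_zero] at e3
    -- With w = f²X, |Aᵢw|² = g(w, Aᵢ²w) = 0.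
    apply eq_zero_of_inner_self S.g
    rw [inner_symPart_swap hA, e3, map_zero]
  obtain ⟨u, hu⟩ := exists_eq_f_f_add hA x v
  rw [hu]
  simp [symPart_ξ hA, key]

end WeakMetricFStructure

/-! ### Rigidity once the ξᵢ are Killing: Q = id, the derivative of f, normality. -/

namespace WeakMetricFStructure

variable {n s : ℕ} {M : Type*} [TopologicalSpace M] [T2Space M]
  [ChartedSpace (EuclideanSpace ℝ (Fin (2 * n + s))) M] [IsManifold (𝓡 (2 * n + s)) ∞ M]
  {S : WeakMetricFStructure n s M} {μ : ℝ}

theorem nabla_ξ_eq_neg_f (hS : S.IsWeakFKappaMu 1 μ) (hL : S.LieQZero) (i : Fin s)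
    (X : VF (2 * n + s) M) : nabla S.g X (S.ξ i) = -app S.f X := by
  ext1 x
  simp [nabla_ξ, symPart_eq_zero hS hL, app]

/-- Differentiate g(Y, ξᵢ) = 0 and use ∇_X ξᵢ = -fX. -/
theorem η_nabla (hS : S.IsWeakFKappaMu 1 μ) (hL : S.LieQZero) (i : Fin s)
    {X Y : VF (2 * n + s) M} (hX : SmoothVF X) (hY : SmoothVF Y) (hYD : S.InContact Y) (x : M) :
    S.η i x (nabla S.g X Y x) = S.g.inner x (Y x) (S.f x (X x)) := by
  have e := along_inner S.g hX hY (S.smooth_ξ i) x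
  rw [nabla_ξ_eq_neg_f hS hL] at e
  simp only [inner_ξ hS.1, hYD _ _, along_const, app, Pi.neg_apply, map_neg] at e
  linarith

theorem inContact_app_f (hA : S.IsWeakAlmostS) (X : VF (2 * n + s) M) :
    S.InContact (app S.f X) := fun x i ↦ η_f hA x i _

theorem Q_eq_id (hs : 0 < s) (hS : S.IsWeakFKappaMu 1 μ) (hL : S.LieQZero)
    (hN : S.NablaQZero) (x : M) (v : TangentSpace (𝓡 (2 * n + s)) x) : S.Q x v = v := by
  have hA := hS.1
  have key : ∀ v, S.Q x (S.f x v) = S.f x v := fun v ↦ by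
    -- The vector u is chosen with f²u = (Q - 1)fv, so that testing (Q - 1)fv against f(fu) yields
    -- its squared norm.
    obtain ⟨u, hu⟩ := exists_eq_f_f_add hA x (S.f x (S.Q x v - v))
    obtain ⟨X, hX, rfl⟩ := exists_smoothVF x u
    obtain ⟨Y, hY, rfl⟩ := exists_smoothVF x v
    have hfX := hX.app S.smooth_f
    have hfY := hY.app S.smooth_f
    have hQfY : S.InContact (app S.Q (app S.f Y)) := fun y i ↦ by
      simp [app, η_Q hA, η_f hA]
    -- As η∘Q = η, this says that ∇_{fX}(QfY) and ∇_{fX}(fY) have the same η-component.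
    have e := congr(S.η ⟨0, hs⟩ x $(hN _ _ hfX hfY (inContact_app_f hA X)
      (inContact_app_f hA Y) x))
    simp only [nablaEnd, app, Pi.sub_apply, map_sub, map_zero, η_Q hA] at e
    rw [sub_eq_zero, ← sub_eq_zero] at e
    have e1 := η_nabla hS hL ⟨0, hs⟩ hfX (hfY.app S.smooth_Q) hQfY x
    have e2 := η_nabla hS hL ⟨0, hs⟩ hfX hfY (inContact_app_f hA Y) x
    simp only [app] at e e1 e2
    rw [e1, e2] at e
    simp only [η_f hA, map_sub, f_Q hA, η_Q hA, sub_zero, zero_smul, Finset.sum_const_zero,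
      add_zero] at hu
    rw [← sub_eq_zero]
    apply eq_zero_of_inner_self S.g
    nth_rw 2 [hu]
    rw [map_sub, sub_apply, e]
  obtain ⟨u, hu⟩ := exists_eq_f_f_add hA x v
  rw [hu]
  simp [key, S.Q_ξ]

theorem nablaEnd_f_swap (hA : S.IsWeakAlmostS) (hs : 0 < s) {X Y Z : VF (2 * n + s) M}
    (hX : SmoothVF X) (hY : SmoothVF Y) (hZ : SmoothVF Z) (x : M) :
    S.g.inner x (nablaEnd S.g X S.f Y x) (Z x) = -S.g.inner x (nablaEnd S.g X S.f Z x) (Y x) := by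
  have e1 := along_inner S.g hX (hY.app S.smooth_f) hZ x
  have e2 := along_inner S.g hX hY (hZ.app S.smooth_f) x
  have e3 : (fun y ↦ S.g.inner y (app S.f Y y) (Z y)) =
      fun y ↦ (-1) * S.g.inner y (Y y) (app S.f Z y) := by
    ext y
    simp [app, inner_f_swap hA hs]
  rw [e3, along_const_mul (smoothFn_inner S.g hY (hZ.app S.smooth_f)), e2] at e1
  simp only [nablaEnd, app, Pi.sub_apply, map_sub, sub_apply] at e1 ⊢
  rw [inner_f_swap hA hs, inner_f_swap hA hs, S.g.symm x _ (Y x), S.g.symm x _ (S.f x (Y x)),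
    inner_f_swap hA hs]
  rw [inner_f_swap hA hs] at e1
  linarith

/-- Substitute ∇ξᵢ = -f; torsion-freeness absorbs the bracket term. -/
theorem curvature_ξ (hS : S.IsWeakFKappaMu 1 μ) (hL : S.LieQZero) (i : Fin s)
    {X Y : VF (2 * n + s) M} (hX : SmoothVF X) (hY : SmoothVF Y) (x : M) :
    curvature S.g X Y (S.ξ i) x = nablaEnd S.g Y S.f X x - nablaEnd S.g X S.f Y x := by
  simp only [curvature, nabla_ξ_eq_neg_f hS hL, nablaEnd, Pi.sub_apply, Pi.neg_apply,
    nabla_neg S.g (hX.app S.smooth_f), nabla_neg S.g (hY.app S.smooth_f)]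
  simp only [app, bracket_eq_nabla S.g hX hY, map_sub]
  abel

/-- The covariant derivative of `f`. -/
theorem nablaEnd_f (hs : 0 < s) (hS : S.IsWeakFKappaMu 1 μ) (hL : S.LieQZero)
    {X Y : VF (2 * n + s) M} (hX : SmoothVF X) (hY : SmoothVF Y) (x : M) :
    nablaEnd S.g X S.f Y x = S.ηbar x (Y x) • S.f x (S.f x (X x))
      - S.g.inner x (S.f x (S.f x (Y x))) (X x) • ∑ i, S.ξ i x := by
  have hA := hS.1
  have cur : ∀ {X Y Z}, SmoothVF X → SmoothVF Y → SmoothVF Z →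
      S.g.inner x (nablaEnd S.g Y S.f X x) (Z x) - S.g.inner x (nablaEnd S.g X S.f Y x) (Z x) =
      S.ηbar x (X x) * S.g.inner x (S.f x (S.f x (Y x))) (Z x)
        - S.ηbar x (Y x) * S.g.inner x (S.f x (S.f x (X x))) (Z x) := fun {X Y Z} hX hY hZ ↦ by
    have e := hS.2 ⟨0, hs⟩ X Y hX hY x
    rw [curvature_ξ hS hL _ hX hY, h_apply hA _ hX, h_apply hA _ hY,
      symPart_eq_zero hS hL, symPart_eq_zero hS hL] at e
    have := congr(S.g.inner x $e (Z x))
    simpa using this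
  have sym : ∀ v w, S.g.inner x (S.f x (S.f x v)) w = S.g.inner x (S.f x (S.f x w)) v :=
    fun v w ↦ by rw [inner_f_swap hA hs, inner_f_swap hA hs, neg_neg, S.g.symm]
  refine eq_of_inner S.g fun w ↦ ?_
  obtain ⟨Z, hZ, rfl⟩ := exists_smoothVF x w
  have hξ : S.g.inner x (∑ i, S.ξ i x) (Z x) = S.ηbar x (Z x) := by
    rw [S.g.symm, map_sum]
    simp [inner_ξ hA, FramedWeakFStructure.ηbar]
  -- As in the Koszul formula: g((∇_X f)Y, Z) is skew in Y, Z, so three cyclic copies of its known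
  -- skew part in X, Y determine it.
  have c1 := cur hX hY hZ
  have c2 := cur hY hZ hX
  have c3 := cur hZ hX hY
  have s1 := nablaEnd_f_swap hA hs hX hY hZ x
  have s2 := nablaEnd_f_swap hA hs hY hZ hX x
  have s3 := nablaEnd_f_swap hA hs hZ hX hY x
  simp only [map_sub, map_smul, sub_apply, smul_apply, smul_eq_mul, hξ]
  rw [sym (Y x) (Z x)] at c1
  rw [sym (Z x) (X x), sym (Y x) (X x)] at c2
  rw [sym (Y x) (X x)]
  linarith

/-- The structure is normal. -/
theorem isNormal (hs : 0 < s) (hS : S.IsWeakFKappaMu 1 μ) (hL : S.LieQZero)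
    (hN : S.NablaQZero) : S.IsNormal := by
  intro X Y hX hY x
  have hA := hS.1
  have hfX := hX.app S.smooth_f
  have hfY := hY.app S.smooth_f
  have nf : ∀ {X Y}, SmoothVF X → SmoothVF Y → nabla S.g X (app S.f Y) x =
      S.f x (nabla S.g X Y x) + (S.ηbar x (Y x) • S.f x (S.f x (X x))
        - S.g.inner x (S.f x (S.f x (Y x))) (X x) • ∑ i, S.ξ i x) := fun {X Y} hX hY ↦ by
    rw [← nablaEnd_f hs hS hL hX hY]
    simp [nablaEnd, app]
  -- The only use of Q = id: f³ = -f.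
  have fff : ∀ v, S.f x (S.f x (S.f x v)) = -S.f x v := fun v ↦ by
    rw [S.f_sq, Q_eq_id hs hS hL hN]
    simp [η_f hA]
  have fξ : S.f x (∑ i, S.ξ i x) = 0 := by simp [f_ξ hA]
  have e1 : S.g.inner x (S.f x (S.f x (Y x))) (S.f x (X x)) =
      S.g.inner x (X x) (S.f x (Y x)) := by
    rw [S.g.symm, inner_f_swap hA hs, fff, map_neg, neg_neg]
  have e2 : S.g.inner x (S.f x (S.f x (X x))) (S.f x (Y x)) =
      -S.g.inner x (X x) (S.f x (Y x)) := by
    rw [inner_f_swap hA hs, inner_f_swap hA hs, neg_neg, fff, map_neg]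
  simp only [hA _ X Y hX hY, ← Finset.smul_sum, nijenhuis, Pi.add_apply, Pi.sub_apply]
  simp only [app, Φ]
  rw [bracket_eq_nabla S.g hX hY, bracket_eq_nabla S.g hfX hfY, bracket_eq_nabla S.g hfX hY,
    bracket_eq_nabla S.g hX hfY, nf hfX hY, nf hfY hX, nf hX hY, nf hY hX]
  -- The η̄-terms and the derivatives of X and Y cancel; along ∑ ξᵢ only [fX, fY] contributes,
  -- namely -2Φ(X, Y).
  simp only [app, e1, e2, map_add, map_sub, map_smul, fξ]
  module

end WeakMetricFStructure

end WeakF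

end

open scoped Manifold ContDiff
theorem theorem3 {n s : ℕ} (hn : 0 < n) (hs : 0 < s)
    {M : Type*} [TopologicalSpace M] [T2Space M] [SecondCountableTopology M]
    [ChartedSpace (EuclideanSpace ℝ (Fin (2 * n + s))) M] [IsManifold (𝓡 (2 * n + s)) ∞ M]
    (S : WeakF.WeakMetricFStructure n s M) (μ : ℝ)
    (hS : S.IsWeakFKappaMu 1 μ) (hLie : S.LieQZero) (hNabla : S.NablaQZero) :
    S.IsS :=
  ⟨⟨S.isNormal hs hS hLie hNabla, hS.1⟩, S.Q_eq_id hs hS hLie hNabla⟩
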